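/- Let $G$ be a finite simple graph that is a cactus (that is, $G$ is connected and any two distinct cycles of $G$ are edge-disjoint) and that contains no cycle of length three, and let $D$ be an orientation of $G$ (every edge $uv$ of $G$ is replaced by exactly one of the arcs $(u,v)$, $(v,u)$). Call a digraph strong locally irregular if $d^+(x)-d^-(x) \neq d^+(y)-d^-(y)$ for each of its arcs $(x,y)$, where $d^+$ and $d^-$ denote the outdegree and the indegree in that digraph, and let $\operatorname{slir}(D)$ be the minimum number of colors in an arc coloring of $D$ in which every color class forms a strong locally irregular digraph. Then $\operatorname{slir}(D) \leq 2$. -/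

import Mathlib

/-- A cactus: a connected graph whose cycles are pairwise edge-disjoint, i.e. two cycles that share
an edge have the same edges. -/
def SimpleGraph.IsCactus {V : Type*} (G : SimpleGraph V) : Prop :=
  G.Connected ∧
    ∀ (u v : V) (p : G.Walk u u) (q : G.Walk v v), p.IsCycle → q.IsCycle →
      (∃ e, e ∈ p.edges ∧ e ∈ q.edges) → ∀ e, e ∈ p.edges ↔ e ∈ q.edges

namespace Digraph

/-- `D` is an orientation of `G`: every edge of `G` is replaced by exactly one of its two arcs, and
`D` has no other arcs. -/
def IsOrientationOf {V : Type*} (D : Digraph V) (G : SimpleGraph V) : Prop :=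
  (∀ u v, G.Adj u v ↔ D.Adj u v ∨ D.Adj v u) ∧ ∀ u v, D.Adj u v → ¬ D.Adj v u

/-- The type of arcs of `D`. -/
abbrev Arc {V : Type*} (D : Digraph V) : Type _ := {a : V × V // D.Adj a.1 a.2}

/-- The balanced degree of a vertex: its outdegree minus its indegree. -/
noncomputable def balancedDegree {V : Type*} (D : Digraph V) (x : V) : ℤ :=
  ({y | D.Adj x y}.ncard : ℤ) - ({y | D.Adj y x}.ncard : ℤ)

/-- A digraph is strong locally irregular if the two ends of every arc have different balanced
degrees. -/
def IsStrongLocallyIrregular {V : Type*} (D : Digraph V) : Prop :=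
  ∀ x y, D.Adj x y → D.balancedDegree x ≠ D.balancedDegree y

/-- The subdigraph of `D` formed by the arcs of colour `i` (with all the vertices of `D`; isolated
vertices play no role in strong local irregularity). -/
def colorClass {V C : Type*} (D : Digraph V) (c : D.Arc → C) (i : C) : Digraph V where
  Adj x y := ∃ h : D.Adj x y, c ⟨(x, y), h⟩ = i

/-- An arc colouring is strong locally irregular if every colour class is. -/
def IsStrongLocallyIrregularColoring {V C : Type*} (D : Digraph V) (c : D.Arc → C) : Prop :=
  ∀ i, (D.colorClass c i).IsStrongLocallyIrregular

/-- The strong locally irregular chromatic index: the minimum number of colours in a strong locally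
irregular colouring (`⊤` if there were no such colouring with finitely many colours). -/
noncomputable def slir {V : Type*} (D : Digraph V) : ℕ∞ :=
  ⨅ k ∈ {k : ℕ | ∃ c : D.Arc → Fin k, D.IsStrongLocallyIrregularColoring c}, (k : ℕ∞)

end Digraph

/-! Suppose first that `G` is bipartite with sides given by `s`. Colour each arc by the side of its
tail: then `z` has only out-arcs in one colour and only in-arcs in the other. On an arc `x → y` the
balances are `outDeg x > 0` and `-inDeg y < 0`, so two colours suffice.

Odd cycles obstruct such an `s`. The remedy is to let a vertex `z` flip the convention on the arcs
to a set `F z` of neighbours. A suitable `s` then exists as soon as every cycle carries flips of the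
same parity as its length (`exists_potential`), and the balances at `z` depend only on `(F z).card`
and the degrees (`slir_le_two_of_flip`).

Fix a root `ρ`. An odd cycle has length at least five, so it contains a path `x', x, y, y'` away
from its vertex nearest to `ρ`. Only `x` and `y` receive flips. These are odd in number on their own
cycle; on any other cycle through `x` or `y` the two edges at that vertex are flipped together or
not at all. The pairs `x, y` chosen on distinct cycles are neither incident nor adjacent
(`InnerPath.eq_of_adj`), so the problem becomes local. `LocalData.exists_localFlip` solves it: if
all small flips fail, the degrees are so constrained that a flip of two pairs works. -/

namespace Digraph

variable {V : Type*}

/-! ### Colourings from flips. -/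

/-- The outdegree of a vertex, as an integer. -/
noncomputable def outDeg (D : Digraph V) (x : V) : ℤ := ({y | D.Adj x y}.ncard : ℤ)

/-- The indegree of a vertex, as an integer. -/
noncomputable def inDeg (D : Digraph V) (x : V) : ℤ := ({y | D.Adj y x}.ncard : ℤ)

/-- The balance at `x`, in the colour of the arc `x → w`, if the neighbours in `A` are flipped. -/
noncomputable def outVal (D : Digraph V) (x : V) (A : Finset V) (w : V) : ℤ :=
  open Classical in if w ∈ A then A.card - D.inDeg x else D.outDeg x - A.card

/-- The balance at `x`, in the colour of the arc `w → x`, if the neighbours in `A` are flipped. -/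
noncomputable def inVal (D : Digraph V) (x : V) (A : Finset V) (w : V) : ℤ :=
  open Classical in if w ∈ A then D.outDeg x - A.card else A.card - D.inDeg x

/-- The indicator of the flipped darts. -/
noncomputable def flipInd (F : V → Finset V) (x y : V) : ZMod 2 :=
  open Classical in if y ∈ F x then 1 else 0

/-- Flipping a neighbour lowers the first balance by one and raises the second by one, whether it is
an out- or an in-neighbour; hence only `A.card` matters. -/
theorem ncard_sub_ncard_of_flip [Finite V] (D : Digraph V) (hD : ∀ u v, D.Adj u v → ¬ D.Adj v u)
    (z : V) (A : Finset V) (hA : ∀ w ∈ A, D.Adj z w ∨ D.Adj w z) :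
    (({w | D.Adj z w ∧ w ∉ A}.ncard : ℤ) - {w | D.Adj w z ∧ w ∈ A}.ncard = D.outDeg z - A.card) ∧
    (({w | D.Adj z w ∧ w ∈ A}.ncard : ℤ) - {w | D.Adj w z ∧ w ∉ A}.ncard = A.card - D.inDeg z) := by
  have h1 : {w | D.Adj z w ∧ w ∈ A}.ncard + {w | D.Adj z w ∧ w ∉ A}.ncard = {w | D.Adj z w}.ncard :=
    Set.ncard_inter_add_ncard_sdiff_eq_ncard {w | D.Adj z w} (A : Set V) (Set.toFinite _)
  have h2 : {w | D.Adj w z ∧ w ∈ A}.ncard + {w | D.Adj w z ∧ w ∉ A}.ncard = {w | D.Adj w z}.ncard :=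
    Set.ncard_inter_add_ncard_sdiff_eq_ncard {w | D.Adj w z} (A : Set V) (Set.toFinite _)
  have h3 : {w | D.Adj z w ∧ w ∈ A}.ncard + {w | D.Adj w z ∧ w ∈ A}.ncard = A.card := by
    rw [← Set.ncard_coe_finset, ← Set.ncard_union_eq]
    · congr 1
      ext w
      simp only [Set.mem_union, Set.mem_ofPred_eq, Finset.mem_coe]
      constructor
      · tauto
      · intro h
        have := hA w h
        tauto
    · rw [Set.disjoint_left]
      rintro w ⟨h, -⟩ ⟨h', -⟩
      exact hD _ _ h h'
  unfold outDeg inDeg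
  omega

/-- At `z`, colour `s z` receives the unflipped out-arcs and the flipped in-arcs, and the other
colour receives the rest. The equation `hs` makes both ends of an arc agree on its colour. -/
theorem slir_le_two_of_flip [Finite V] (D : Digraph V) (hD : ∀ u v, D.Adj u v → ¬ D.Adj v u)
    (F : V → Finset V) (hF : ∀ z, ∀ w ∈ F z, D.Adj z w ∨ D.Adj w z)
    (s : V → ZMod 2)
    (hs : ∀ x y, D.Adj x y → s x + s y + flipInd F x y + flipInd F y x = 1)
    (hval : ∀ x y, D.Adj x y → D.outVal x (F x) y ≠ D.inVal y (F y) x) :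
    D.slir ≤ 2 := by
  classical
  -- `Fin 2` and `ZMod 2` agree definitionally.
  let c : D.Arc → Fin 2 := fun a => (s a.1.1 + flipInd F a.1.1 a.1.2 : ZMod 2)
  have hbin : ∀ a : ZMod 2, a = 0 ∨ a = 1 := by decide
  have hout : ∀ (z : V) (i : ZMod 2), {w | (D.colorClass c i).Adj z w} =
      {w | D.Adj z w ∧ s z + flipInd F z w = i} := by
    intro z i; ext w; exact ⟨fun ⟨h, h'⟩ => ⟨h, h'⟩, fun ⟨h, h'⟩ => ⟨h, h'⟩⟩
  have hin : ∀ (z : V) (i : ZMod 2), {w | (D.colorClass c i).Adj w z} =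
      {w | D.Adj w z ∧ s z + flipInd F z w = i + 1} := by
    intro z i; ext w
    have key : ∀ a b d e i : ZMod 2, a + b + d + e = 1 → (a + d = i ↔ b + e = i + 1) := by decide
    constructor
    · rintro ⟨h, h'⟩
      exact ⟨h, (key _ _ _ _ _ (hs w z h)).1 h'⟩
    · rintro ⟨h, h'⟩
      exact ⟨h, (key _ _ _ _ _ (hs w z h)).2 h'⟩
  have hP : ∀ z, (D.colorClass c (s z)).balancedDegree z = D.outDeg z - (F z).card := by
    intro z
    rw [← (ncard_sub_ncard_of_flip D hD z (F z) (hF z)).1, balancedDegree, hout, hin]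
    congr 3 <;> ext w <;> simp [flipInd]
  have hN : ∀ z, (D.colorClass c (s z + 1 : ZMod 2)).balancedDegree z
      = (F z).card - D.inDeg z := by
    intro z
    rw [← (ncard_sub_ncard_of_flip D hD z (F z) (hF z)).2, balancedDegree, hout, hin]
    have : ∀ a : ZMod 2, a + 1 + 1 = a := by decide
    rw [this]
    congr 3 <;> ext w <;> simp [flipInd]
  have hc : D.IsStrongLocallyIrregularColoring c := by
    rintro i x y ⟨h, rfl⟩
    have h1 : (D.colorClass c (c ⟨(x, y), h⟩)).balancedDegree x = D.outVal x (F x) y := by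
      unfold outVal
      split_ifs with hm
      · rw [← hN]; simp [c, flipInd, hm]
      · rw [← hP]; simp [c, flipInd, hm]
    have h2 : (D.colorClass c (c ⟨(x, y), h⟩)).balancedDegree y = D.inVal y (F y) x := by
      have key : ∀ a b d e : ZMod 2, a + b + d + e = 1 → a + d = b + e + 1 := by decide
      have e' : (c ⟨(x, y), h⟩) = (s y + flipInd F y x + 1 : ZMod 2) := key _ _ _ _ (hs x y h)
      rw [e']
      unfold inVal
      split_ifs with hm
      · rw [← hP]
        have : s y + flipInd F y x + 1 = s y := by
          have : ∀ a : ZMod 2, a + 1 + 1 = a := by decide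
          simp [flipInd, hm, this]
        rw [this]
      · rw [← hN]; simp [flipInd, hm]
    rw [h1, h2]
    exact hval x y h
  exact iInf₂_le (2 : ℕ) ⟨c, hc⟩

end Digraph

/-! ### Potentials modulo 2 on a connected graph. -/

namespace SimpleGraph

variable {V : Type*} {G : SimpleGraph V}

/-- The sum of a weight over the darts of a walk. -/
def Walk.dartSum (f : V → V → ZMod 2) {u v : V} (p : G.Walk u v) : ZMod 2 :=
  (p.darts.map fun d => f d.fst d.snd).sum

@[simp] theorem Walk.dartSum_nil (f : V → V → ZMod 2) (u : V) :
    (Walk.nil : G.Walk u u).dartSum f = 0 := rfl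

@[simp] theorem Walk.dartSum_cons (f : V → V → ZMod 2) {u v w : V} (h : G.Adj u v)
    (p : G.Walk v w) : (Walk.cons h p).dartSum f = f u v + p.dartSum f := by
  simp [Walk.dartSum]

theorem Walk.dartSum_append (f : V → V → ZMod 2) {u v w : V} (p : G.Walk u v) (q : G.Walk v w) :
    (p.append q).dartSum f = p.dartSum f + q.dartSum f := by
  simp [Walk.dartSum]

/-- Each closed piece cut off by `bypass` is either a cycle or a single edge traversed back and
forth, whose weight cancels in characteristic 2. -/
theorem Walk.dartSum_bypass [DecidableEq V] (f : V → V → ZMod 2) (hf : ∀ u v, f u v = f v u)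
    (hc : ∀ (u : V) (p : G.Walk u u), p.IsCycle → p.dartSum f = 0)
    {u v : V} (p : G.Walk u v) : p.bypass.dartSum f = p.dartSum f := by
  induction p with
  | nil => rfl
  | @cons u v w h p ih =>
    rw [Walk.bypass]
    split_ifs with hs
    · rw [Walk.dartSum_cons, ← ih]
      conv_rhs => rw [← Walk.take_spec p.bypass hs, Walk.dartSum_append, ← add_assoc]
      rw [← Walk.dartSum_cons f h, right_eq_add]
      have hpath : (p.bypass.takeUntil u hs).IsPath := (p.bypass_isPath).takeUntil hs
      by_cases he : s(u, v) ∈ (p.bypass.takeUntil u hs).edges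
      · generalize p.bypass.takeUntil u hs = q at hpath he
        cases q with
        | nil => simp at he
        | @cons _ x _ h' q =>
          have hx : x = u := by
            have := (Walk.cons_isPath_iff h' q).1 hpath
            rw [Walk.edges_cons, List.mem_cons] at he
            rcases he with he | he
            · rw [Sym2.eq_iff] at he
              rcases he with ⟨rfl, rfl⟩ | ⟨h1, -⟩
              · exact absurd rfl h'.ne
              · exact h1.symm
            · exact absurd (Walk.snd_mem_support_of_mem_edges q he) this.2
          subst hx
          have hq : q = Walk.nil := by
            have := (Walk.cons_isPath_iff h' q).1 hpath
            exact (Walk.isPath_iff_nil.1 this.1).eq_nil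
          subst hq
          rw [Walk.dartSum_cons, Walk.dartSum_cons, hf v x, Walk.dartSum_nil, add_zero]
          exact CharTwo.add_self_eq_zero _
      · exact hc _ _ ((Walk.cons_isCycle_iff _ h).2 ⟨hpath, he⟩)
    · rw [Walk.dartSum_cons, Walk.dartSum_cons, ih]

theorem exists_potential (hG : G.Connected) (f : V → V → ZMod 2) (hf : ∀ u v, f u v = f v u)
    (hc : ∀ (u : V) (p : G.Walk u u), p.IsCycle → p.dartSum f = 0) :
    ∃ s : V → ZMod 2, ∀ u v, G.Adj u v → s u + s v = f u v := by
  classical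
  have hclosed : ∀ (u : V) (p : G.Walk u u), p.dartSum f = 0 := by
    intro u p
    rw [← p.dartSum_bypass f hf hc, (Walk.isPath_iff_nil.1 p.bypass_isPath).eq_nil,
      Walk.dartSum_nil]
  obtain ⟨r⟩ := hG.nonempty
  have hw : ∀ v, ∃ p : G.Walk v r, True := fun v => ⟨(hG.preconnected v r).some, trivial⟩
  choose p _ using hw
  have hrev : ∀ {u v : V} (p : G.Walk u v), p.reverse.dartSum f = p.dartSum f := by
    intro u v p
    induction p with
    | nil => rfl
    | cons h p ih =>
      rw [Walk.reverse_cons, Walk.dartSum_append, ih, Walk.dartSum_cons, Walk.dartSum_cons,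
        Walk.dartSum_nil, add_zero, hf, add_comm]
  refine ⟨fun v => (p v).dartSum f, fun u v h => ?_⟩
  have := hclosed u (Walk.cons h ((p v).append (p u).reverse))
  rw [Walk.dartSum_cons, Walk.dartSum_append, hrev] at this
  have key : ∀ a b d : ZMod 2, a + (b + d) = 0 → d + b = a := by decide
  exact key _ _ _ this

/-- Regrouping by vertex lets the flips on a cycle be counted one vertex at a time. -/
theorem Walk.dartSum_add_symm [Fintype V] [DecidableEq V] (g : V → V → ZMod 2) {u v : V}
    (p : G.Walk u v) :
    p.dartSum (fun x y => g x y + g y x) =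
      ∑ x, ∑ y, (p.edges.count s(x, y) : ZMod 2) * g x y := by
  induction p with
  | nil => simp
  | @cons u v w h p ih =>
    rw [Walk.dartSum_cons, ih, Walk.edges_cons]
    have : ∑ x, ∑ y, (if s(u, v) = s(x, y) then g x y else 0) = g u v + g v u := by
      rw [Finset.sum_eq_add u v h.ne]
      · congr 1
        · rw [Finset.sum_eq_single v] <;> simp +contextual [h.ne', eq_comm]
        · rw [Finset.sum_eq_single u] <;> simp +contextual [h.ne, h.ne', eq_comm]
      · intro c _ hc
        apply Finset.sum_eq_zero
        intro y _
        rw [if_neg]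
        rw [Sym2.eq_iff]
        rintro (⟨rfl, rfl⟩ | ⟨rfl, rfl⟩)
        · exact hc.1 rfl
        · exact hc.2 rfl
      · simp
      · simp
    rw [← this, ← Finset.sum_add_distrib]
    refine Finset.sum_congr rfl fun x _ => ?_
    rw [← Finset.sum_add_distrib]
    refine Finset.sum_congr rfl fun y _ => ?_
    rw [List.count_cons]
    by_cases hxy : s(u, v) = s(x, y)
    · simp [hxy]; ring
    · simp [hxy]

end SimpleGraph

/-! ### Cycles of a cactus, seen from a root. -/

namespace SimpleGraph

variable {V : Type*} {G : SimpleGraph V} {E E' : Set (Sym2 V)}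

/-- `E` is the edge set of a cycle of `G`. -/
def IsCycleEdges (G : SimpleGraph V) (E : Set (Sym2 V)) : Prop :=
  ∃ (u : V) (p : G.Walk u u), p.IsCycle ∧ ∀ e, e ∈ E ↔ e ∈ p.edges

theorem IsCycleEdges.exists_walk (hE : G.IsCycleEdges E) {v w : V} (hv : s(v, w) ∈ E) :
    ∃ p : G.Walk v v, p.IsCycle ∧ ∀ e, e ∈ E ↔ e ∈ p.edges := by
  classical
  obtain ⟨u, p, hp, he⟩ := hE
  have hs : v ∈ p.support := Walk.fst_mem_support_of_mem_edges p ((he _).1 hv)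
  exact ⟨p.rotate v hs, hp.rotate hs, fun e => by rw [he, (p.rotate_edges v hs).mem_iff]⟩

theorem IsCycleEdges.adj (hE : G.IsCycleEdges E) {v w : V} (hv : s(v, w) ∈ E) : G.Adj v w := by
  obtain ⟨u, p, hp, he⟩ := hE
  exact p.adj_of_mem_edges ((he _).1 hv)

theorem IsCycleEdges.exists_nbrs (hE : G.IsCycleEdges E) {v w : V} (hv : s(v, w) ∈ E) :
    ∃ w₁ w₂, w₁ ≠ w₂ ∧ ∀ w, s(v, w) ∈ E ↔ w = w₁ ∨ w = w₂ := by
  obtain ⟨p, hp, he⟩ := hE.exists_walk hv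
  obtain ⟨w₁, w₂, hne, h⟩ := Set.ncard_eq_two.1
    (hp.ncard_neighborSet_toSubgraph_eq_two p.start_mem_support)
  refine ⟨w₁, w₂, hne, fun w => ?_⟩
  rw [he, ← Walk.adj_toSubgraph_iff_mem_edges, ← Subgraph.mem_neighborSet, h]
  simp

theorem IsCycleEdges.nbr_eq (hE : G.IsCycleEdges E) {v a b w : V} (ha : s(v, a) ∈ E)
    (hb : s(v, b) ∈ E) (hab : a ≠ b) (hw : s(v, w) ∈ E) : w = a ∨ w = b := by
  obtain ⟨w₁, w₂, -, h⟩ := hE.exists_nbrs ha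
  rw [h] at ha hb hw
  grind

theorem IsCactus.eq_of_mem (hG : G.IsCactus) (hE : G.IsCycleEdges E) (hE' : G.IsCycleEdges E')
    {e : Sym2 V} (h : e ∈ E) (h' : e ∈ E') : E = E' := by
  obtain ⟨u, p, hp, he⟩ := hE
  obtain ⟨u', p', hp', he'⟩ := hE'
  ext x
  rw [he, he']
  exact hG.2 u u' p p' hp hp' ⟨e, (he _).1 h, (he' _).1 h'⟩ x

theorem Walk.reachable_deleteEdges {u v : V} (p : G.Walk u v) (h : ∀ e ∈ p.edges, e ∉ E) :
    (G.deleteEdges E).Reachable u v :=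
  ⟨p.toDeleteEdges E h⟩

/-- Two vertices of a cycle of a cactus are joined only through the edges of the cycle. -/
theorem IsCactus.not_reachable (hG : G.IsCactus) (hE : G.IsCycleEdges E) {u v a b : V}
    (hu : s(u, a) ∈ E) (hv : s(v, b) ∈ E) (huv : u ≠ v) :
    ¬ (G.deleteEdges E).Reachable u v := by
  classical
  rintro ⟨q⟩
  obtain ⟨p, hp, he⟩ := hE.exists_walk hu
  have hvp : v ∈ p.support := Walk.fst_mem_support_of_mem_edges p ((he _).1 hv)
  have hspec := p.take_spec hvp
  have hnd := hp.edges_nodup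
  rw [← hspec, Walk.edges_append] at hnd
  have hmem : ∀ e, e ∈ E ↔ e ∈ (p.takeUntil v hvp).edges ∨ e ∈ (p.dropUntil v hvp).edges := by
    intro e; rw [he]; conv_lhs => rw [← hspec, Walk.edges_append, List.mem_append]
  generalize p.takeUntil v hvp = q₁ at hnd hmem
  generalize p.dropUntil v hvp = q₂ at hnd hmem
  cases q₁ with
  | nil => exact huv rfl
  | @cons _ x _ h₁ q₁ =>
  cases q₂ with
  | nil => exact huv rfl
  | @cons _ y _ h₂ q₂ =>
  rw [Walk.edges_cons, Walk.edges_cons] at hnd hmem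
  have hf : s(v, y) ∈ E := by rw [hmem]; right; simp
  have heE : s(u, x) ∈ E := by rw [hmem]; left; simp
  have hef : s(u, x) ≠ s(v, y) := by
    intro hc
    rw [hc] at hnd
    simp at hnd
  -- Without the edge `s(v, y)` of the second arc, `s(u, x)` still lies on a cycle, since `q` and
  -- the rest of the first arc join its ends. That cycle shares an edge with `E` but misses another.
  let H := G.deleteEdges {s(v, y)}
  have hxv : (H.deleteEdges {s(u, x)}).Reachable x v := by
    rw [deleteEdges_deleteEdges]
    refine q₁.reachable_deleteEdges fun e he => ?_
    rintro (hc | hc)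
    · rw [Set.mem_singleton_iff.1 hc] at he
      exact List.disjoint_of_nodup_append hnd (List.mem_cons_of_mem _ he) List.mem_cons_self
    · rw [Set.mem_singleton_iff.1 hc] at he
      simp [he] at hnd
  have huv' : (H.deleteEdges {s(u, x)}).Reachable u v := by
    rw [deleteEdges_deleteEdges]
    refine Reachable.mono (deleteEdges_anti ?_) ⟨q⟩
    rintro e (hc | hc)
    · rw [Set.mem_singleton_iff.1 hc]; exact hf
    · rw [Set.mem_singleton_iff.1 hc]; exact heE
  have hadj : H.Adj u x := by
    rw [deleteEdges_adj]
    exact ⟨h₁, hef⟩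
  obtain ⟨z, r, hr, her⟩ := adj_and_reachable_delete_edges_iff_exists_cycle.1
    ⟨hadj, huv'.trans hxv.symm⟩
  have hle : H ≤ G := deleteEdges_le _
  have hEq := hG.eq_of_mem hE (E' := {e | e ∈ r.edges})
    ⟨z, r.mapLe hle, hr.mapLe hle, fun e => by rw [Walk.edges_mapLe_eq_edges]; rfl⟩ heE her
  rw [hEq] at hf
  have := r.edges_subset_edgeSet hf
  rw [edgeSet_deleteEdges] at this
  exact this.2 rfl

theorem Walk.exists_reachable_deleteEdges {u v a : V} (p : G.Walk u v) (hv : s(v, a) ∈ E) : ∃ r b, s(r, b) ∈ E ∧ (G.deleteEdges E).Reachable u r := by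
  induction p with
  | nil => exact ⟨_, _, hv, .rfl⟩
  | @cons x y _ h p ih =>
    by_cases he : s(x, y) ∈ E
    · exact ⟨x, y, he, .rfl⟩
    · obtain ⟨r, b, hr, h'⟩ := ih hv
      refine ⟨r, b, hr, Reachable.trans (Adj.reachable ?_) h'⟩
      rw [deleteEdges_adj]
      exact ⟨h, he⟩

theorem IsCycleEdges.reachable_of_disjoint (hE : G.IsCycleEdges E) (h : ∀ e ∈ E, e ∉ E')
    {u v a b : V} (hu : s(u, a) ∈ E) (hv : s(v, b) ∈ E) : (G.deleteEdges E').Reachable u v := by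
  classical
  obtain ⟨p, hp, he⟩ := hE.exists_walk hu
  have hvp : v ∈ p.support := Walk.fst_mem_support_of_mem_edges p ((he _).1 hv)
  exact (p.takeUntil v hvp).reachable_deleteEdges
    fun e h' => h e ((he e).2 (p.edges_takeUntil_subset_edges hvp h'))

/-- Two distinct cycles of a connected graph that are edge-disjoint and attached to each other
cannot be both entered, from a fixed vertex `ρ`, elsewhere. -/
theorem IsCactus.eq_of_nonroot (hG : G.IsCactus) (hE : G.IsCycleEdges E)
    (hE' : G.IsCycleEdges E') {ρ u v a b : V} (hu : s(u, a) ∈ E) (hv : s(v, b) ∈ E')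
    (huv : (G.deleteEdges E).Reachable u v) (huv' : (G.deleteEdges E').Reachable u v)
    (hρ : ¬ (G.deleteEdges E).Reachable ρ u) (hρ' : ¬ (G.deleteEdges E').Reachable ρ v) :
    E = E' := by
  classical
  by_contra hne
  have hd : ∀ e ∈ E, e ∉ E' := fun e h h' => hne (hG.eq_of_mem hE hE' h h')
  have hd' : ∀ e ∈ E', e ∉ E := fun e h h' => hd e h' h
  obtain ⟨r, c, hr, ⟨p⟩⟩ := (hG.1.preconnected ρ u).some.exists_reachable_deleteEdges hu
  -- `p` runs from `ρ` to a vertex of `E` off the edges of `E`. If it meets `E'`, going round `E'`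
  -- to `v` and on to `u` avoids `E`; otherwise going round `E` to `u` and on to `v` avoids `E'`.
  by_cases hp : ∃ e ∈ p.edges, e ∈ E'
  · obtain ⟨e, hep, heE⟩ := hp
    induction e with
    | _ x y =>
    refine hρ (Reachable.trans ⟨p.takeUntil x (Walk.fst_mem_support_of_mem_edges p hep)⟩ ?_)
    exact (hE'.reachable_of_disjoint hd' heE hv).trans huv.symm
  · push Not at hp
    refine hρ' (Reachable.trans (v := r) ?_ ((hE.reachable_of_disjoint hd hr hu).trans huv'))
    have := (p.mapLe (deleteEdges_le E)).reachable_deleteEdges (E := E')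
      (fun e he => hp e (by rwa [Walk.edges_mapLe_eq_edges] at he))
    exact this

/-- A cycle of length at least five contains a path on four vertices away from a given
vertex. -/
theorem IsCycleEdges.exists_path (hE : G.IsCycleEdges E) {r a : V} (hr : s(r, a) ∈ E)
    (h5 : 5 ≤ E.ncard) : ∃ v₁ v₂ v₃ v₄, s(v₂, v₁) ∈ E ∧ s(v₂, v₃) ∈ E ∧ s(v₃, v₄) ∈ E ∧
      v₁ ≠ v₃ ∧ v₂ ≠ v₄ ∧ v₁ ≠ r ∧ v₂ ≠ r ∧ v₃ ≠ r ∧ v₄ ≠ r := by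
  classical
  obtain ⟨p, hp, he⟩ := hE.exists_walk hr
  have hlen : 5 ≤ p.length := by
    have : E = (p.edges.toFinset : Set (Sym2 V)) := by ext e; simp [he]
    rw [this, Set.ncard_coe_finset] at h5
    exact h5.trans ((List.toFinset_card_le _).trans p.length_edges.le)
  have hne : ∀ i j, i < 5 → j < 5 → i ≠ j → p.getVert i ≠ p.getVert j := by
    intro i j hi hj hij h
    exact hij (hp.getVert_injOn' (by rw [Set.mem_ofPred_eq]; omega)
      (by rw [Set.mem_ofPred_eq]; omega) h)
  have h0 : p.getVert 0 = r := p.getVert_zero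
  have hmem : ∀ i, i < 5 → s(p.getVert i, p.getVert (i + 1)) ∈ E := fun i hi => by
    rw [he, Walk.mk_mem_edges_iff_exists]
    exact ⟨i, by omega, rfl⟩
  -- Index 0 is `r`; length at least five keeps the indices 0 to 4 distinct.
  refine ⟨p.getVert 1, p.getVert 2, p.getVert 3, p.getVert 4, ?_, hmem 2 (by omega),
    hmem 3 (by omega), ?_⟩
  · rw [Sym2.eq_swap]; exact hmem 1 (by omega)
  · have hr0 : ∀ i, 0 < i → i < 5 → p.getVert i ≠ r := fun i hi hi' h =>
      hne i 0 hi' (by omega) (by omega) (h.trans h0.symm)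
    exact ⟨hne 1 3 (by omega) (by omega) (by omega), hne 2 4 (by omega) (by omega) (by omega),
      hr0 1 (by omega) (by omega), hr0 2 (by omega) (by omega), hr0 3 (by omega) (by omega),
      hr0 4 (by omega) (by omega)⟩

end SimpleGraph

/-! ### The local problem at an arc of an odd cycle. -/

namespace Digraph

variable {V : Type*}

/-- The reverse of a digraph. -/
def rev (D : Digraph V) : Digraph V where
  Adj x y := D.Adj y x

/-- Two vertices joined by an arc in either direction. -/
def Nbr (D : Digraph V) (x y : V) : Prop := D.Adj x y ∨ D.Adj y x

/-- With the neighbours in `A` flipped, `z` does not conflict with its neighbour `w`, provided that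
nothing is flipped at `w`. -/
def FlipOK (D : Digraph V) (z : V) (A : Finset V) (w : V) : Prop :=
  (D.Adj z w → D.outVal z A w ≠ -D.inDeg w) ∧ (D.Adj w z → D.outDeg w ≠ D.inVal z A w)

/-- The difference of the indegrees along an out-arc at `z`, and of the outdegrees along an
in-arc. -/
noncomputable def gap (D : Digraph V) (z w : V) : ℤ :=
  open Classical in if D.Adj z w then D.inDeg z - D.inDeg w else D.outDeg z - D.outDeg w

/-- An arc `x → y` on a path `x', x, y, y'`, with a pairing of the other neighbours of `x` and
of `y`. -/
structure LocalData (D : Digraph V) (x y x' y' : V) (σ τ : V → V) : Prop where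
  asymm : ∀ u v, D.Adj u v → ¬ D.Adj v u
  adj : D.Adj x y
  nbr_x : D.Nbr x x'
  ne_x : x' ≠ y
  nbr_y : D.Nbr y y'
  ne_y : y' ≠ x
  pair_x : ∀ w, D.Nbr x w → w ≠ y → w ≠ x' → D.Nbr x (σ w) ∧ σ w ≠ y ∧ σ w ≠ x' ∧ σ (σ w) = w
  pair_y : ∀ w, D.Nbr y w → w ≠ x → w ≠ y' → D.Nbr y (τ w) ∧ τ w ≠ x ∧ τ w ≠ y' ∧ τ (τ w) = w

/-- Sets of flips at the ends of the arc `x → y` that respect the pairings, change the parity along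
the path `x', x, y, y'` and create no conflict. -/
structure LocalFlip (D : Digraph V) (x y x' y' : V) (σ τ : V → V) (A B : Finset V) : Prop where
  sub_x : ∀ w ∈ A, D.Nbr x w
  sub_y : ∀ w ∈ B, D.Nbr y w
  closed_x : ∀ w, D.Nbr x w → w ≠ y → w ≠ x' → (w ∈ A ↔ σ w ∈ A)
  closed_y : ∀ w, D.Nbr y w → w ≠ x → w ≠ y' → (w ∈ B ↔ τ w ∈ B)
  parity : (y ∈ A ↔ x' ∈ A) ↔ ¬ (x ∈ B ↔ y' ∈ B)
  ok_x : ∀ w, w ≠ y → D.FlipOK x A w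
  ok_y : ∀ w, w ≠ x → D.FlipOK y B w
  arc : D.outVal x A y ≠ D.inVal y B x

section rev

variable {D : Digraph V} {x y x' y' : V} {σ τ : V → V}

theorem rev_nbr {u v : V} : D.rev.Nbr u v ↔ D.Nbr u v := or_comm

theorem rev_outVal (z : V) (A : Finset V) (w : V) : D.rev.outVal z A w = -D.inVal z A w := by
  classical
  unfold outVal inVal
  change (if _ then (A.card : ℤ) - D.outDeg z else D.inDeg z - A.card) = _
  split_ifs <;> ring

theorem rev_inVal (z : V) (A : Finset V) (w : V) : D.rev.inVal z A w = -D.outVal z A w := by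
  classical
  unfold outVal inVal
  change (if _ then D.inDeg z - (A.card : ℤ) else (A.card : ℤ) - D.outDeg z) = _
  split_ifs <;> ring

theorem rev_flipOK {z : V} {A : Finset V} {w : V} (h : D.rev.FlipOK z A w) : D.FlipOK z A w := by
  refine ⟨fun h' e => h.2 h' ?_, fun h' e => h.1 h' ?_⟩
  · rw [rev_inVal, e, neg_neg]; rfl
  · rw [rev_outVal, ← e]; rfl

theorem LocalData.rev (h : D.LocalData x y x' y' σ τ) : D.rev.LocalData y x y' x' τ σ where
  asymm u v h1 h2 := h.asymm _ _ h1 h2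
  adj := h.adj
  nbr_x := rev_nbr.2 h.nbr_y
  ne_x := h.ne_y
  nbr_y := rev_nbr.2 h.nbr_x
  ne_y := h.ne_x
  pair_x w := by simpa only [rev_nbr] using h.pair_y w
  pair_y w := by simpa only [rev_nbr] using h.pair_x w

theorem LocalFlip.of_rev {A B : Finset V} (h : D.rev.LocalFlip y x y' x' τ σ A B) :
    D.LocalFlip x y x' y' σ τ B A where
  sub_x w hw := rev_nbr.1 (h.sub_y w hw)
  sub_y w hw := rev_nbr.1 (h.sub_x w hw)
  closed_x w := by simpa only [rev_nbr] using h.closed_y w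
  closed_y w := by simpa only [rev_nbr] using h.closed_x w
  parity := by have := h.parity; tauto
  ok_x w hw := rev_flipOK (h.ok_y w hw)
  ok_y w hw := rev_flipOK (h.ok_x w hw)
  arc e := h.arc (by rw [rev_outVal, rev_inVal, e])

theorem exists_localFlip_of_rev (h : ∃ A B, D.rev.LocalFlip y x y' x' τ σ A B) :
    ∃ A B, D.LocalFlip x y x' y' σ τ A B := by
  obtain ⟨A, B, h⟩ := h
  exact ⟨B, A, h.of_rev⟩

theorem rev_gap (h : ∀ u v, D.Adj u v → ¬ D.Adj v u) {u v : V} (huv : D.Nbr u v) :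
    D.rev.gap u v = D.gap u v := by
  classical
  unfold gap
  change (if D.Adj v u then D.outDeg u - D.outDeg v else D.inDeg u - D.inDeg v) = _
  rcases huv with huv | huv
  · rw [if_pos huv, if_neg (h _ _ huv)]
  · rw [if_pos huv, if_neg (h _ _ huv)]

theorem LocalData.gap_adj (h : D.LocalData x y x' y' σ τ) : D.gap y x = D.outDeg y - D.outDeg x := by
  rw [gap, if_neg (h.asymm _ _ h.adj)]

theorem LocalData.even_card (h : D.LocalData x y x' y' σ τ)
    (hτ : ∀ w, D.Nbr y w → w ≠ x → w ≠ y' → τ w ≠ w) {H : Finset V}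
    (hH : ∀ w, w ∈ H ↔ D.Nbr y w ∧ w ≠ x ∧ w ≠ y') : Even H.card := by
  have : ∑ w ∈ H, (1 : ZMod 2) = 0 := by
    refine Finset.sum_involution (fun w _ => τ w) (fun _ _ => by decide) ?_ ?_ ?_
    · intro w hw _
      rw [hH] at hw
      exact hτ w hw.1 hw.2.1 hw.2.2
    · intro w hw
      rw [hH] at hw ⊢
      have := h.pair_y w hw.1 hw.2.1 hw.2.2
      exact ⟨this.1, this.2.1, this.2.2.1⟩
    · intro w hw
      rw [hH] at hw
      exact (h.pair_y w hw.1 hw.2.1 hw.2.2).2.2.2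
  rw [Finset.sum_const, nsmul_one] at this
  exact (ZMod.natCast_eq_zero_iff_even).1 this

end rev

section

variable [Finite V] {D : Digraph V} {x y x' y' : V} {σ τ : V → V}

theorem one_le_outDeg {u v : V} (h : D.Adj u v) : 1 ≤ D.outDeg u := by
  have : 0 < {w | D.Adj u w}.ncard := (Set.ncard_pos (Set.toFinite _)).2 ⟨v, h⟩
  unfold outDeg; omega

theorem one_le_inDeg {u v : V} (h : D.Adj u v) : 1 ≤ D.inDeg v :=
  one_le_outDeg (D := D.rev) (u := v) (v := u) h

theorem two_le_outDeg {u v w : V} (h : D.Adj u v) (h' : D.Adj u w) (hne : v ≠ w) :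
    2 ≤ D.outDeg u := by
  have : 1 < {w | D.Adj u w}.ncard := (Set.one_lt_ncard (Set.toFinite _)).2 ⟨v, h, w, h', hne⟩
  unfold outDeg; omega

/-- With `A.card` bounded by both degrees, an unflipped arc has balances of weakly opposite signs,
one of them nonzero. Only a flipped neighbour whose gap equals `A.card` can conflict. -/
theorem flipOK_of_le (hD : ∀ u v, D.Adj u v → ¬ D.Adj v u) {z : V} {A : Finset V}
    (h₁ : (A.card : ℤ) ≤ D.outDeg z) (h₂ : (A.card : ℤ) ≤ D.inDeg z)
    (h : ∀ w ∈ A, D.gap z w ≠ A.card) (w : V) : D.FlipOK z A w := by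
  refine ⟨fun ha => ?_, fun ha => ?_⟩
  · have := one_le_inDeg ha
    unfold outVal
    split_ifs with hw
    · have := h w hw
      rw [gap, if_pos ha] at this
      omega
    · omega
  · have := one_le_outDeg ha
    unfold inVal
    split_ifs with hw
    · have := h w hw
      rw [gap, if_neg (hD _ _ ha)] at this
      omega
    · omega

theorem flipOK_empty (hD : ∀ u v, D.Adj u v → ¬ D.Adj v u) (z w : V) : D.FlipOK z ∅ w :=
  flipOK_of_le hD (by simp [outDeg]) (by simp [inDeg]) (by simp) w

namespace LocalData

/-- Flipping `y` at `x`, and an additional set at `y`. -/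
theorem exists_of_singleton (h : D.LocalData x y x' y' σ τ) (B : Finset V)
    (hB : ∀ w ∈ B, D.Nbr y w ∧ w ≠ x ∧ w ≠ y') (hτ : ∀ w ∈ B, τ w ∈ B)
    (hcard : D.inDeg x ≠ D.inDeg y + 1 - B.card) (hok : ∀ w, w ≠ x → D.FlipOK y B w) :
    ∃ A B, D.LocalFlip x y x' y' σ τ A B := by
  have hx : x ∉ B := fun hx => (hB x hx).2.1 rfl
  have hy : y' ∉ B := fun hy => (hB y' hy).2.2 rfl
  refine ⟨{y}, B, ⟨?_, fun w hw => (hB w hw).1, ?_, ?_, ?_, ?_, hok, ?_⟩⟩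
  · intro w hw
    rw [Finset.mem_singleton] at hw
    exact hw ▸ Or.inl h.adj
  · intro w hw h1 h2
    have := h.pair_x w hw h1 h2
    simp [h1, this.2.1]
  · intro w hw h1 h2
    refine ⟨hτ w, fun h3 => ?_⟩
    have := hτ _ h3
    rwa [(h.pair_y w hw h1 h2).2.2.2] at this
  · simp [hx, hy, h.ne_x]
  · intro w hw
    have h1 := one_le_outDeg h.adj
    refine ⟨fun ha => ?_, fun ha => ?_⟩
    · have := one_le_inDeg ha
      simp [outVal, hw]
      omega
    · have := one_le_inDeg ha
      have := one_le_outDeg ha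
      simp [inVal, hw]
      omega
  -- A conflict along `x → y` would read `1 - inDeg x = B.card - inDeg y`.
  · simp [outVal, inVal, hx]
    omega

/-- Flipping nothing at `x`, and `x` together with an additional set at `y`. -/
theorem exists_of_insert [DecidableEq V] (h : D.LocalData x y x' y' σ τ) (B : Finset V)
    (hB : ∀ w ∈ B, D.Nbr y w ∧ w ≠ x ∧ w ≠ y') (hτ : ∀ w ∈ B, τ w ∈ B)
    (hcard : D.outDeg y ≠ D.outDeg x + 1 + B.card) (hok : ∀ w, D.FlipOK y (insert x B) w) :
    ∃ A B, D.LocalFlip x y x' y' σ τ A B := by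
  have hx : x ∉ B := fun hx => (hB x hx).2.1 rfl
  have hy : y' ∉ B := fun hy => (hB y' hy).2.2 rfl
  refine ⟨∅, insert x B, ⟨by simp, ?_, by simp, ?_, ?_, fun w _ => flipOK_empty h.asymm x w,
    fun w _ => hok w, ?_⟩⟩
  · intro w hw
    rw [Finset.mem_insert] at hw
    rcases hw with rfl | hw
    · exact Or.inr h.adj
    · exact (hB w hw).1
  · intro w hw h1 h2
    have h4 := h.pair_y w hw h1 h2
    simp only [Finset.mem_insert, h1, h4.2.1, false_or]
    refine ⟨hτ w, fun h3 => ?_⟩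
    have := hτ _ h3
    rwa [h4.2.2.2] at this
  · simp [hy, h.ne_y]
  · simp [outVal, inVal, Finset.card_insert_of_notMem hx]
    omega

/-- Flipping only `x'` at `x`. -/
theorem exists_of_gap_ne_one (h : D.LocalData x y x' y' σ τ) (hin : 1 ≤ D.inDeg x)
    (hgap : D.gap x x' ≠ 1) : ∃ A B, D.LocalFlip x y x' y' σ τ A B := by
  have h1 := one_le_outDeg h.adj
  have h2 := one_le_inDeg h.adj
  refine ⟨{x'}, ∅, ⟨?_, by simp, ?_, by simp, ?_, fun w _ => flipOK_of_le h.asymm ?_ ?_ ?_ w,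
    fun w _ => flipOK_empty h.asymm y w, ?_⟩⟩
  · intro w hw
    rw [Finset.mem_singleton] at hw
    exact hw ▸ h.nbr_x
  · intro w hw h1 h2
    have := h.pair_x w hw h1 h2
    simp [h2, this.2.2.1]
  · simp [h.ne_x.symm]
  · simpa using h1
  · simpa using hin
  · simpa using hgap
  · simp [outVal, inVal, h.ne_x.symm]
    omega

theorem two_le_outDeg (h : D.LocalData x y x' y' σ τ) (hgap : D.gap x x' = 1) :
    2 ≤ D.outDeg x := by
  rcases h.nbr_x with hx | hx
  · exact Digraph.two_le_outDeg h.adj hx h.ne_x.symm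
  · rw [gap, if_neg (h.asymm _ _ hx)] at hgap
    have := one_le_outDeg hx
    omega

/-- A neighbour of `y` left alone by the pairing makes a local flip possible. -/
theorem exists_of_fixed (h : D.LocalData x y x' y' σ τ) (hin : D.inDeg x = D.inDeg y + 1)
    (hout : D.outDeg y = D.outDeg x + 1) (h2 : 2 ≤ D.inDeg y) {w : V} (hw : D.Nbr y w)
    (hwx : w ≠ x) (hwy : w ≠ y') (hτ : τ w = w) : ∃ A B, D.LocalFlip x y x' y' σ τ A B := by
  classical
  have h1 := one_le_outDeg h.adj
  have hgx := h.gap_adj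
  -- If the gap is 1, flip `{x, w}`: both of its gaps are 1, not 2. Otherwise `{w}` itself is
  -- harmless at `y`.
  by_cases hg : D.gap y w = 1
  · refine h.exists_of_insert {w} (by simp [*]) (by simp [hτ]) (by simp [hout])
      (flipOK_of_le h.asymm ?_ ?_ ?_)
    · rw [Finset.card_pair hwx.symm]; push_cast; omega
    · rw [Finset.card_pair hwx.symm]; push_cast; omega
    · rw [Finset.card_pair hwx.symm]
      simp only [Finset.mem_insert, Finset.mem_singleton, forall_eq_or_imp, forall_eq]
      push_cast; omega
  · refine h.exists_of_singleton {w} (by simp [*]) (by simp [hτ]) (by simp [hin])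
      fun u _ => flipOK_of_le h.asymm ?_ ?_ ?_ u
    · simp; omega
    · simp; omega
    · simpa using hg

theorem card_nbr (h : D.LocalData x y x' y' σ τ) :
    ∃ H : Finset V, (∀ w, w ∈ H ↔ D.Nbr y w ∧ w ≠ x ∧ w ≠ y') ∧
      (H.card : ℤ) + 2 = D.outDeg y + D.inDeg y := by
  classical
  have : Fintype V := Fintype.ofFinite V
  let N : Finset V := Finset.univ.filter fun w => D.Nbr y w
  refine ⟨N \ {x, y'}, by simp [N], ?_⟩
  have hN : (N.card : ℤ) = D.outDeg y + D.inDeg y := by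
    unfold outDeg inDeg
    rw [← Nat.cast_add, ← Set.ncard_union_eq, ← Set.ncard_coe_finset]
    · congr 2; ext w; simp [N]; rfl
    · rw [Set.disjoint_left]
      exact fun w h1 h2 => h.asymm _ _ h1 h2
  have hsub : ({x, y'} : Finset V) ⊆ N := by
    intro w hw
    simp only [Finset.mem_insert, Finset.mem_singleton] at hw
    rcases hw with rfl | rfl
    · exact Finset.mem_filter.2 ⟨Finset.mem_univ _, Or.inr h.adj⟩
    · simpa [N] using h.nbr_y
  have := Finset.card_sdiff_add_card_eq_card hsub
  rw [Finset.card_pair h.ne_y.symm] at this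
  omega

/-- If no flip exists, each pair fails both alone (size 2) and together with `x` (size 3), so its
gaps are 2 and 3. Both degrees of `y` are at least 3, which leaves room for two pairs; their union
has size 4, above every gap. -/
theorem exists_of_lt (h : D.LocalData x y x' y' σ τ) (hin : D.inDeg x = D.inDeg y + 1)
    (hout : D.outDeg y = D.outDeg x + 1) (h2 : 2 ≤ D.outDeg x) (hlt : D.outDeg x < D.inDeg y)
    (hgy : D.gap y y' = 1) (hτ : ∀ w, D.Nbr y w → w ≠ x → w ≠ y' → τ w ≠ w) :
    ∃ A B, D.LocalFlip x y x' y' σ τ A B := by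
  classical
  by_contra hno
  obtain ⟨H, hH, hcard⟩ := h.card_nbr
  have heven := h.even_card hτ hH
  have hgx := h.gap_adj
  have hmem : ∀ w ∈ H, τ w ∈ H ∧ τ (τ w) = w ∧ τ w ≠ w := by
    intro w hw
    rw [hH] at hw
    have := h.pair_y w hw.1 hw.2.1 hw.2.2
    exact ⟨(hH _).2 ⟨this.1, this.2.1, this.2.2.1⟩, this.2.2.2, hτ w hw.1 hw.2.1 hw.2.2⟩
  have hpair : ∀ w ∈ H, ∀ u ∈ ({w, τ w} : Finset V), u ∈ H := by
    intro w hw u hu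
    simp only [Finset.mem_insert, Finset.mem_singleton] at hu
    rcases hu with rfl | rfl
    exacts [hw, (hmem _ hw).1]
  have hpairτ : ∀ w ∈ H, ∀ u ∈ ({w, τ w} : Finset V), τ u ∈ ({w, τ w} : Finset V) := by
    intro w hw u hu
    have := hmem w hw
    simp only [Finset.mem_insert, Finset.mem_singleton] at hu ⊢
    rcases hu with rfl | rfl <;> simp [this.2.1]
  have hgap : ∀ w ∈ H, D.gap y w = 2 ∨ D.gap y w = 3 := by
    intro w hw
    have hm := hmem w hw
    have hc : ({w, τ w} : Finset V).card = 2 := Finset.card_pair hm.2.2.symm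
    have hx : x ∉ ({w, τ w} : Finset V) := fun hx => ((hH x).1 (hpair w hw x hx)).2.1 rfl
    have hc' : (insert x ({w, τ w} : Finset V)).card = 3 := by
      rw [Finset.card_insert_of_notMem hx, hc]
    have e2 : D.gap y w = 2 ∨ D.gap y (τ w) = 2 := by
      by_contra hg
      refine hno (h.exists_of_singleton {w, τ w} (fun u hu => (hH u).1 (hpair w hw u hu))
        (hpairτ w hw) (by rw [hc]; push_cast; omega) fun u _ => flipOK_of_le h.asymm ?_ ?_ ?_ u)
      · rw [hc]; push_cast; omega
      · rw [hc]; push_cast; omega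
      · rw [hc]
        simp only [Finset.mem_insert, Finset.mem_singleton, forall_eq_or_imp, forall_eq]
        push_cast; omega
    have e3 : D.gap y w = 3 ∨ D.gap y (τ w) = 3 := by
      by_contra hg
      refine hno (h.exists_of_insert {w, τ w} (fun u hu => (hH u).1 (hpair w hw u hu))
        (hpairτ w hw) (by rw [hc]; push_cast; omega) (flipOK_of_le h.asymm ?_ ?_ ?_))
      · rw [hc']; push_cast; omega
      · rw [hc']; push_cast; omega
      · rw [hc']
        simp only [Finset.mem_insert, Finset.mem_singleton, forall_eq_or_imp, forall_eq]
        push_cast; omega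
    omega
  obtain ⟨w, hw⟩ : H.Nonempty := by rw [← Finset.card_pos]; omega
  have hmw := hmem w hw
  obtain ⟨v, hv⟩ : (H \ {w, τ w}).Nonempty := by
    rw [← Finset.card_pos]
    have := Finset.le_card_sdiff ({w, τ w} : Finset V) H
    have := Finset.card_pair hmw.2.2.symm
    omega
  rw [Finset.mem_sdiff] at hv
  obtain ⟨hv, hvw⟩ := hv
  have hmv := hmem v hv
  have hτvw : τ v ∉ ({w, τ w} : Finset V) := by
    intro hc
    have := hpairτ w hw _ hc
    rw [hmv.2.1] at this
    exact hvw this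
  let B : Finset V := {v, τ v} ∪ {w, τ w}
  have hB4 : B.card = 4 := by
    rw [Finset.card_union_of_disjoint, Finset.card_pair hmw.2.2.symm,
      Finset.card_pair hmv.2.2.symm]
    rw [Finset.disjoint_left]
    intro u hu
    simp only [Finset.mem_insert, Finset.mem_singleton] at hu
    rcases hu with rfl | rfl
    exacts [hvw, hτvw]
  have hBH : B ⊆ H := Finset.union_subset (hpair v hv) (hpair w hw)
  -- Here `outDeg x = 2`, so `outDeg y = 3` and `H` has exactly four elements.
  have hthree : D.inDeg y = 3 → H ⊆ B := by
    intro h3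
    rw [← Finset.eq_of_subset_of_card_le hBH (by omega)]
  -- Four may exceed a degree of `y`, so unflipped neighbours need checking too. By parity, if
  -- `outDeg y = 3` and `inDeg y ≠ 3`, then `inDeg y ≥ 5`, so unflipped out-neighbours have indegree
  -- at least 2.
  obtain ⟨k, hk⟩ := heven
  refine hno (h.exists_of_singleton B (fun u hu => (hH u).1 (hBH hu)) ?_
    (by rw [hB4]; push_cast; omega) ?_)
  · intro u hu
    rw [Finset.mem_union] at hu ⊢
    exact hu.imp (hpairτ v hv u) (hpairτ w hw u)
  · intro u hux
    have hu : D.Nbr y u → u ∉ B → (u = y' ∨ (D.inDeg y ≠ 3 ∧ u ∈ H)) := by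
      intro hn hu
      by_cases hy : u = y'
      · exact Or.inl hy
      · have : u ∈ H := (hH u).2 ⟨hn, hux, hy⟩
        exact Or.inr ⟨fun h3 => hu (hthree h3 this), this⟩
    refine ⟨fun ha => ?_, fun ha => ?_⟩
    · have hd := one_le_inDeg ha
      unfold outVal
      have hg : D.gap y u = D.inDeg y - D.inDeg u := by rw [gap, if_pos ha]
      rw [hB4]
      split_ifs with hm
      · have := hgap u (hBH hm)
        push_cast; omega
      · rcases hu (Or.inl ha) hm with rfl | ⟨h3, hm'⟩
        · push_cast; omega
        · have := hgap u hm'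
          push_cast; omega
    · have hd := one_le_outDeg ha
      unfold inVal
      have hg : D.gap y u = D.outDeg y - D.outDeg u := by rw [gap, if_neg (h.asymm _ _ ha)]
      rw [hB4]
      split_ifs with hm
      · have := hgap u (hBH hm)
        push_cast; omega
      · rcases hu (Or.inr ha) hm with rfl | ⟨h3, hm'⟩
        · push_cast; omega
        · push_cast; omega

theorem exists_localFlip (h : D.LocalData x y x' y' σ τ) :
    ∃ A B, D.LocalFlip x y x' y' σ τ A B := by
  by_contra hno
  have hno' : ¬ ∃ A B, D.rev.LocalFlip y x y' x' τ σ A B :=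
    fun h' => hno (exists_localFlip_of_rev h')
  have hr := h.rev
  have hin : D.inDeg x = D.inDeg y + 1 := by
    by_contra hc
    exact hno (h.exists_of_singleton ∅ (by simp) (by simp) (by simpa using hc)
      fun w _ => flipOK_empty h.asymm y w)
  have hout : D.outDeg y = D.outDeg x + 1 := by
    by_contra hc
    exact hno' (hr.exists_of_singleton ∅ (by simp) (by simp)
      (by simpa using (show D.rev.inDeg y ≠ D.rev.inDeg x + 1 from hc))
      fun w _ => flipOK_empty hr.asymm x w)
  have hox := one_le_outDeg h.adj
  have hiy := one_le_inDeg h.adj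
  have hgx : D.gap x x' = 1 := by
    by_contra hc
    exact hno (h.exists_of_gap_ne_one (by omega) hc)
  have hgy' : D.rev.gap y y' = 1 := by
    by_contra hc
    exact hno' (hr.exists_of_gap_ne_one (show 1 ≤ D.outDeg y by omega) hc)
  have hgy : D.gap y y' = 1 := by rwa [rev_gap h.asymm h.nbr_y] at hgy'
  have hgx' : D.rev.gap x x' = 1 := by rwa [rev_gap h.asymm h.nbr_x]
  have h2x := h.two_le_outDeg hgx
  have h2y : 2 ≤ D.inDeg y := hr.two_le_outDeg hgy'
  have hτ : ∀ w, D.Nbr y w → w ≠ x → w ≠ y' → τ w ≠ w := fun w h1 h2 h3 h4 =>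
    hno (h.exists_of_fixed hin hout h2y h1 h2 h3 h4)
  have hσ : ∀ w, D.rev.Nbr x w → w ≠ y → w ≠ x' → σ w ≠ w := fun w h1 h2 h3 h4 =>
    hno' (hr.exists_of_fixed hout hin h2x h1 h2 h3 h4)
  obtain ⟨H, hH, hcard⟩ := h.card_nbr
  obtain ⟨k, hk⟩ := h.even_card hτ hH
  rcases lt_trichotomy (D.outDeg x) (D.inDeg y) with hlt | heq | hlt
  · exact hno (h.exists_of_lt hin hout h2x hlt hgy hτ)
  -- Equality would make `H.card = 2 * outDeg x - 1`, which is odd.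
  · omega
  · exact hno' (hr.exists_of_lt hout hin h2y hlt hgx' hσ)

end LocalData

end

end Digraph

/-! ### Pairing by cycles, and inner paths on distinct cycles. -/

namespace SimpleGraph

variable {V : Type*} {G : SimpleGraph V} {E : Set (Sym2 V)}

theorem Walk.IsCycle.ncard_edges {u : V} {p : G.Walk u u} (hp : p.IsCycle)
    (he : ∀ e, e ∈ E ↔ e ∈ p.edges) : E.ncard = p.length := by
  classical
  have : E = (p.edges.toFinset : Set (Sym2 V)) := by ext e; simp [he]
  rw [this, Set.ncard_coe_finset, List.toFinset_card_of_nodup hp.edges_nodup, p.length_edges]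

theorem Walk.dartSum_one_add (g : V → V → ZMod 2) {u v : V} (p : G.Walk u v) :
    p.dartSum (fun x y => 1 + g x y) = p.length + p.dartSum g := by
  induction p with
  | nil => simp
  | cons h p ih => rw [Walk.dartSum_cons, Walk.dartSum_cons, ih, Walk.length_cons]; push_cast; ring

/-- The second neighbour of `z` on the cycle through the edge `zw`, or `w` itself if there is no
such cycle. -/
noncomputable def partner (G : SimpleGraph V) (z w : V) : V :=
  open Classical in
  if h : ∃ w', w' ≠ w ∧ ∃ E, G.IsCycleEdges E ∧ s(z, w) ∈ E ∧ s(z, w') ∈ E then h.choose else w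

theorem partner_spec (G : SimpleGraph V) (z w : V) : G.partner z w = w ∨
    G.partner z w ≠ w ∧ ∃ E, G.IsCycleEdges E ∧ s(z, w) ∈ E ∧ s(z, G.partner z w) ∈ E := by
  by_cases h : ∃ w', w' ≠ w ∧ ∃ E, G.IsCycleEdges E ∧ s(z, w) ∈ E ∧ s(z, w') ∈ E
  · right
    rw [partner, dif_pos h]
    exact h.choose_spec
  · left
    rw [partner, dif_neg h]

theorem IsCactus.partner_eq (hG : G.IsCactus) (hE : G.IsCycleEdges E) {z a b : V}
    (ha : s(z, a) ∈ E) (hb : s(z, b) ∈ E) (hab : a ≠ b) : G.partner z a = b := by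
  have h : ∃ w', w' ≠ a ∧ ∃ E, G.IsCycleEdges E ∧ s(z, a) ∈ E ∧ s(z, w') ∈ E :=
    ⟨b, hab.symm, E, hE, ha, hb⟩
  rcases G.partner_spec z a with h' | ⟨hne, E', hE', ha', hb'⟩
  · rw [partner, dif_pos h] at h'
    exact absurd h' h.choose_spec.1
  · obtain rfl := hG.eq_of_mem hE hE' ha ha'
    exact (hE.nbr_eq ha hb hab hb').resolve_left hne

theorem IsCactus.partner_pair (hG : G.IsCactus) (hE : G.IsCycleEdges E) {z a b w : V}
    (ha : s(z, a) ∈ E) (hb : s(z, b) ∈ E) (hab : a ≠ b) (hw : G.Adj z w) (hwa : w ≠ a)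
    (hwb : w ≠ b) : G.Adj z (G.partner z w) ∧ G.partner z w ≠ a ∧ G.partner z w ≠ b ∧
      G.partner z (G.partner z w) = w := by
  rcases G.partner_spec z w with h | ⟨hne, E', hE', hw', hp'⟩
  · rw [h]
    exact ⟨hw, hwa, hwb, h⟩
  · have hEE : E ≠ E' := by
      rintro rfl
      exact (hE.nbr_eq ha hb hab hw').elim hwa hwb
    refine ⟨hE'.adj hp', ?_, ?_, hG.partner_eq hE' hp' hw' hne⟩
    · intro h
      exact hEE (hG.eq_of_mem hE hE' ha (h ▸ hp'))
    · intro h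
      exact hEE (hG.eq_of_mem hE hE' hb (h ▸ hp'))

/-- The four vertices of a path on the cycle `E` that avoids the vertex of `E` closest to `ρ`. -/
structure InnerPath (G : SimpleGraph V) (ρ : V) (E : Set (Sym2 V)) (x y x' y' : V) : Prop where
  mem : s(x, y) ∈ E
  mem_x : s(x, x') ∈ E
  mem_y : s(y, y') ∈ E
  ne_x : x' ≠ y
  ne_y : y' ≠ x
  inner_x : ¬ (G.deleteEdges E).Reachable ρ x
  inner_y : ¬ (G.deleteEdges E).Reachable ρ y
  inner_x' : ¬ (G.deleteEdges E).Reachable ρ x'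
  inner_y' : ¬ (G.deleteEdges E).Reachable ρ y'

theorem InnerPath.symm {ρ x y x' y' : V} (h : G.InnerPath ρ E x y x' y') :
    G.InnerPath ρ E y x y' x' :=
  ⟨Sym2.eq_swap ▸ h.mem, h.mem_y, h.mem_x, h.ne_y, h.ne_x, h.inner_y, h.inner_x, h.inner_y',
    h.inner_x'⟩

theorem IsCactus.exists_innerPath (hG : G.IsCactus) (hE : G.IsCycleEdges E) (h5 : 5 ≤ E.ncard)
    (ρ : V) : ∃ x y x' y', G.InnerPath ρ E x y x' y' := by
  have hne : E.Nonempty := by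
    rw [Set.nonempty_iff_ne_empty]
    rintro rfl
    simp at h5
  obtain ⟨e, he⟩ := hne
  induction e with
  | _ u a =>
  obtain ⟨r, b, hr, hρ⟩ := (hG.1.preconnected ρ u).some.exists_reachable_deleteEdges he
  obtain ⟨v₁, v₂, v₃, v₄, h1, h2, h3, h13, h24, n1, n2, n3, n4⟩ := hE.exists_path hr h5
  have hin : ∀ {v c : V}, s(v, c) ∈ E → v ≠ r → ¬ (G.deleteEdges E).Reachable ρ v :=
    fun hv hvr hρv => hG.not_reachable hE hv hr hvr (hρv.symm.trans hρ)
  exact ⟨v₂, v₃, v₁, v₄, h2, h1, h3, h13, h24.symm, hin h2 n2, hin h3 n3,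
    hin (Sym2.eq_swap ▸ h1) n1, hin (Sym2.eq_swap ▸ h3) n4⟩

/-- The inner edges chosen on two distinct cycles are neither incident nor adjacent. -/
theorem InnerPath.eq_of_adj (hG : G.IsCactus) {E' : Set (Sym2 V)} (hE : G.IsCycleEdges E)
    (hE' : G.IsCycleEdges E') {ρ x y x' y' u v u' v' : V} (h : G.InnerPath ρ E x y x' y')
    (h' : G.InnerPath ρ E' u v u' v') (hxu : x = u ∨ G.Adj x u) : E = E' := by
  rcases hxu with rfl | hadj
  · exact hG.eq_of_nonroot hE hE' h.mem h'.mem .rfl .rfl h.inner_x h'.inner_x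
  -- The neighbours of `x` on `E` are `y` and `x'`. Both must be inner, which is why `InnerPath`
  -- constrains all four vertices.
  · by_cases h1 : s(x, u) ∈ E
    · have : ¬ (G.deleteEdges E).Reachable ρ u := by
        rcases hE.nbr_eq h.mem h.mem_x h.ne_x.symm h1 with rfl | rfl
        exacts [h.inner_y, h.inner_x']
      exact hG.eq_of_nonroot hE hE' (Sym2.eq_swap ▸ h1) h'.mem .rfl .rfl this h'.inner_x
    · by_cases h2 : s(x, u) ∈ E'
      · rw [Sym2.eq_swap] at h2
        have : ¬ (G.deleteEdges E').Reachable ρ x := by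
          rcases hE'.nbr_eq h'.mem h'.mem_x h'.ne_x.symm h2 with rfl | rfl
          exacts [h'.inner_y, h'.inner_x']
        exact hG.eq_of_nonroot hE hE' h.mem (Sym2.eq_swap ▸ h2) .rfl .rfl h.inner_x this
      · refine hG.eq_of_nonroot hE hE' h.mem h'.mem (Adj.reachable ?_) (Adj.reachable ?_)
          h.inner_x h'.inner_x
        · rw [deleteEdges_adj]; exact ⟨hadj, h1⟩
        · rw [deleteEdges_adj]; exact ⟨hadj, h2⟩

theorem IsCycleEdges.sum_eq [Fintype V] [DecidableEq V] (hE : G.IsCycleEdges E) {u : V}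
    {p : G.Walk u u} (hp : p.IsCycle) (he : ∀ e, e ∈ E ↔ e ∈ p.edges) (g : V → ZMod 2)
    {z a b : V} (ha : s(z, a) ∈ E) (hb : s(z, b) ∈ E) (hab : a ≠ b) :
    ∑ w, (p.edges.count s(z, w) : ZMod 2) * g w = g a + g b := by
  rw [Finset.sum_eq_add a b hab]
  · rw [List.count_eq_one_of_mem hp.edges_nodup ((he _).1 ha),
      List.count_eq_one_of_mem hp.edges_nodup ((he _).1 hb)]
    simp
  · intro c _ hc
    rw [List.count_eq_zero_of_not_mem]
    · simp
    · intro hm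
      exact (hE.nbr_eq ha hb hab ((he _).2 hm)).elim hc.1 hc.2
  · simp
  · simp

end SimpleGraph

/-! ### Assembling the local flips. -/

theorem mainTheorem6 {V : Type*} [Finite V] (G : SimpleGraph V) (hG : G.IsCactus)
    (h3 : ∀ (v : V) (p : G.Walk v v), p.IsCycle → p.length ≠ 3)
    (D : Digraph V) (hD : D.IsOrientationOf G) :
    D.slir ≤ 2 := by
  classical
  have : Fintype V := Fintype.ofFinite V
  obtain ⟨hadj, hasymm⟩ := hD
  have hnbr : ∀ u v, D.Nbr u v ↔ G.Adj u v := fun u v => (hadj u v).symm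
  obtain ⟨ρ⟩ := hG.1.nonempty
  let O := {E : Set (Sym2 V) // G.IsCycleEdges E ∧ Odd E.ncard}
  have hlocal : ∀ E : O, ∃ x y x' y', ∃ A B : Finset V, G.InnerPath ρ E.1 x y x' y' ∧
      D.Adj x y ∧ D.LocalFlip x y x' y' (G.partner x) (G.partner y) A B := by
    rintro ⟨E, hE, hodd⟩
    have h5 : 5 ≤ E.ncard := by
      obtain ⟨u, p, hp, he⟩ := hE
      rw [hp.ncard_edges he] at hodd ⊢
      have h1 := hp.three_le_length
      have h2 := h3 u p hp
      obtain ⟨k, hk⟩ := hodd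
      omega
    have key : ∃ x y x' y', G.InnerPath ρ E x y x' y' ∧ D.Adj x y := by
      obtain ⟨x, y, x', y', h⟩ := hG.exists_innerPath hE h5 ρ
      rcases (hadj x y).1 (hE.adj h.mem) with h' | h'
      exacts [⟨x, y, x', y', h, h'⟩, ⟨y, x, y', x', h.symm, h'⟩]
    obtain ⟨x, y, x', y', h, h'⟩ := key
    have hdata : D.LocalData x y x' y' (G.partner x) (G.partner y) :=
      { asymm := hasymm
        adj := h'
        nbr_x := (hnbr _ _).2 (hE.adj h.mem_x)
        ne_x := h.ne_x
        nbr_y := (hnbr _ _).2 (hE.adj h.mem_y)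
        ne_y := h.ne_y
        pair_x := fun w hw => by
          rw [hnbr] at hw ⊢
          exact hG.partner_pair hE h.mem h.mem_x h.ne_x.symm hw
        pair_y := fun w hw => by
          rw [hnbr] at hw ⊢
          exact hG.partner_pair hE h.symm.mem h.mem_y h.ne_y.symm hw }
    obtain ⟨A, B, hAB⟩ := hdata.exists_localFlip
    exact ⟨x, y, x', y', A, B, h, h', hAB⟩
  choose x y x' y' A B hpath hxy hflip using hlocal
  have hxx : ∀ E E', x E = x E' ∨ G.Adj (x E) (x E') → E = E' := fun E E' h =>
    Subtype.ext (SimpleGraph.InnerPath.eq_of_adj hG E.2.1 E'.2.1 (hpath E) (hpath E') h)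
  have hyy : ∀ E E', y E = y E' ∨ G.Adj (y E) (y E') → E = E' := fun E E' h =>
    Subtype.ext (SimpleGraph.InnerPath.eq_of_adj hG E.2.1 E'.2.1 (hpath E).symm (hpath E').symm h)
  have hxy' : ∀ E E', x E = y E' ∨ G.Adj (x E) (y E') → E = E' := fun E E' h =>
    Subtype.ext (SimpleGraph.InnerPath.eq_of_adj hG E.2.1 E'.2.1 (hpath E) (hpath E').symm h)
  have hne : ∀ E, x E ≠ y E := fun E => (E.2.1.adj (hpath E).mem).ne
  have hinj : Function.Injective (Sum.elim x y) := by
    rintro (E | E) (E' | E') h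
    · rw [hxx E E' (Or.inl h)]
    · have := hxy' E E' (Or.inl h)
      subst this
      exact absurd h (hne E)
    · have := hxy' E' E (Or.inl h.symm)
      subst this
      exact absurd h.symm (hne _)
    · rw [hyy E E' (Or.inl h)]
  obtain ⟨F, hFx, hFy, hF0⟩ : ∃ F : V → Finset V, (∀ E, F (x E) = A E) ∧ (∀ E, F (y E) = B E) ∧
      ∀ z, (∀ E, z ≠ x E ∧ z ≠ y E) → F z = ∅ := by
    refine ⟨Function.extend (Sum.elim x y) (Sum.elim A B) fun _ => ∅, fun E => ?_, fun E => ?_,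
      fun z hz => ?_⟩
    · exact hinj.extend_apply (Sum.elim A B) (fun _ => ∅) (Sum.inl E)
    · exact hinj.extend_apply (Sum.elim A B) (fun _ => ∅) (Sum.inr E)
    · apply Function.extend_apply'
      rintro ⟨E | E, rfl⟩
      exacts [(hz E).1 rfl, (hz E).2 rfl]
  have hcases : ∀ z, (∃ E, z = x E) ∨ (∃ E, z = y E) ∨ (∀ E, z ≠ x E ∧ z ≠ y E) := by
    intro z
    by_cases h1 : ∃ E, z = x E
    · exact Or.inl h1
    · by_cases h2 : ∃ E, z = y E
      · exact Or.inr (Or.inl h2)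
      · push Not at h1 h2
        exact Or.inr (Or.inr fun E => ⟨h1 E, h2 E⟩)
  -- Every cycle carries the right parity.
  have hcycle : ∀ (u : V) (p : G.Walk u u), p.IsCycle →
      p.dartSum (fun a b => 1 + (Digraph.flipInd F a b + Digraph.flipInd F b a)) = 0 := by
    intro u p hp
    rw [SimpleGraph.Walk.dartSum_one_add, SimpleGraph.Walk.dartSum_add_symm]
    let E : Set (Sym2 V) := {e | e ∈ p.edges}
    have he : ∀ e, e ∈ E ↔ e ∈ p.edges := fun e => Iff.rfl
    have hE : G.IsCycleEdges E := ⟨u, p, hp, he⟩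
    -- The two edges of `E` at `z` are partners, and `F z` contains both ends or neither, so their
    -- contributions cancel modulo 2.
    have hother : ∀ z (a b : V) (E' : Set (Sym2 V)), G.IsCycleEdges E' → s(z, a) ∈ E' →
        s(z, b) ∈ E' → E' ≠ E →
        (∀ w, D.Nbr z w → w ≠ a → w ≠ b → (w ∈ F z ↔ G.partner z w ∈ F z)) →
        ∑ w, (p.edges.count s(z, w) : ZMod 2) * Digraph.flipInd F z w = 0 := by
      intro z a b E' hE' ha hb hEE hcl
      by_cases hz : ∃ w, s(z, w) ∈ E
      · obtain ⟨w, hw⟩ := hz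
        obtain ⟨w₁, w₂, hw12, hw⟩ := hE.exists_nbrs hw
        have hw1 : s(z, w₁) ∈ E := (hw _).2 (Or.inl rfl)
        have hw2 : s(z, w₂) ∈ E := (hw _).2 (Or.inr rfl)
        rw [hE.sum_eq hp he _ hw1 hw2 hw12]
        have h1 := hcl w₁ ((hnbr _ _).2 (hE.adj hw1))
          (fun h => hEE (hG.eq_of_mem hE' hE ha (h ▸ hw1)))
          (fun h => hEE (hG.eq_of_mem hE' hE hb (h ▸ hw1)))
        rw [hG.partner_eq hE hw1 hw2 hw12] at h1
        unfold Digraph.flipInd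
        simp only [h1]
        exact CharTwo.add_self_eq_zero _
      · push Not at hz
        apply Finset.sum_eq_zero
        intro w _
        rw [List.count_eq_zero_of_not_mem (hz w)]
        simp
    have hotherx : ∀ E' : O, E'.1 ≠ E →
        ∑ w, (p.edges.count s(x E', w) : ZMod 2) * Digraph.flipInd F (x E') w = 0 :=
      fun E' hEE => hother (x E') (y E') (x' E') E'.1 E'.2.1 (hpath E').mem (hpath E').mem_x hEE
        (by rw [hFx]; exact (hflip E').closed_x)
    have hothery : ∀ E' : O, E'.1 ≠ E →
        ∑ w, (p.edges.count s(y E', w) : ZMod 2) * Digraph.flipInd F (y E') w = 0 :=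
      fun E' hEE => hother (y E') (x E') (y' E') E'.1 E'.2.1 (hpath E').symm.mem (hpath E').mem_y
        hEE (by rw [hFy]; exact (hflip E').closed_y)
    have hnone : ∀ z, (∀ E, z ≠ x E ∧ z ≠ y E) →
        ∑ w, (p.edges.count s(z, w) : ZMod 2) * Digraph.flipInd F z w = 0 := by
      intro z hz
      simp [Digraph.flipInd, hF0 z hz]
    have hlen := hp.ncard_edges he
    rcases Nat.even_or_odd E.ncard with hpar | hpar
    · rw [Finset.sum_eq_zero, add_zero, ZMod.natCast_eq_zero_iff_even, ← hlen]
      · exact hpar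
      · intro z _
        have hEO : ∀ E' : O, E'.1 ≠ E := fun E' h =>
          Nat.not_even_iff_odd.2 E'.2.2 (h ▸ hpar)
        rcases hcases z with ⟨E', rfl⟩ | ⟨E', rfl⟩ | hz
        exacts [hotherx E' (hEO E'), hothery E' (hEO E'), hnone z hz]
    -- On an odd cycle only its own `x` and `y` contribute; the odd number of flips there cancels
    -- the odd length.
    · let E₀ : O := ⟨E, hE, hpar⟩
      have hp₀ := hpath E₀
      have hf₀ := (hflip E₀).parity
      rw [Finset.sum_eq_add (x E₀) (y E₀) (hne E₀),
        hE.sum_eq hp he _ hp₀.mem hp₀.mem_x hp₀.ne_x.symm,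
        hE.sum_eq hp he _ hp₀.symm.mem hp₀.mem_y hp₀.ne_y.symm,
        (ZMod.natCast_eq_one_iff_odd).2 (hlen ▸ hpar)]
      · unfold Digraph.flipInd
        rw [hFx, hFy]
        by_cases c1 : y E₀ ∈ A E₀ <;> by_cases c2 : x' E₀ ∈ A E₀ <;>
          by_cases c3 : x E₀ ∈ B E₀ <;> by_cases c4 : y' E₀ ∈ B E₀ <;>
          simp only [c1, c2, c3, c4, if_true, if_false] at hf₀ ⊢ <;>
          first | decide | simp at hf₀
      · intro z _ hz
        rcases hcases z with ⟨E', rfl⟩ | ⟨E', rfl⟩ | hz'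
        · exact hotherx E' fun h => hz.1 (by rw [show E' = E₀ from Subtype.ext h])
        · exact hothery E' fun h => hz.2 (by rw [show E' = E₀ from Subtype.ext h])
        · exact hnone z hz'
      · simp
      · simp
  obtain ⟨s, hs⟩ := SimpleGraph.exists_potential hG.1 _ (fun u v => by rw [add_comm (Digraph.flipInd F u v)])
    hcycle
  refine Digraph.slir_le_two_of_flip D hasymm F ?_ s ?_ ?_
  · intro z w hw
    rcases hcases z with ⟨E, rfl⟩ | ⟨E, rfl⟩ | hz
    · exact (hflip E).sub_x w (hFx E ▸ hw)
    · exact (hflip E).sub_y w (hFy E ▸ hw)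
    · rw [hF0 z hz] at hw
      simp at hw
  · intro u v huv
    have key : ∀ a b c d : ZMod 2, a + b = 1 + (c + d) → a + b + c + d = 1 := by decide
    exact key _ _ _ _ (hs u v ((hadj u v).2 (Or.inl huv)))
  · intro u v huv
    have hG' : G.Adj u v := (hadj u v).2 (Or.inl huv)
    have hin : ∀ z w, D.inVal z ∅ w = -D.inDeg z := fun z w => by simp [Digraph.inVal]
    have hout : ∀ z w, D.outVal z ∅ w = D.outDeg z := fun z w => by simp [Digraph.outVal]
    -- Two adjacent flipped vertices belong to the same cycle, so they form its chosen arc; any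
    -- other arc has an unflipped end.
    rcases hcases u with ⟨E, rfl⟩ | ⟨E, rfl⟩ | hu <;>
      rcases hcases v with ⟨E', rfl⟩ | ⟨E', rfl⟩ | hv
    · have := hxx E E' (Or.inr hG')
      subst this
      exact absurd rfl hG'.ne
    · have := hxy' E E' (Or.inr hG')
      subst this
      rw [hFx, hFy]
      exact (hflip E).arc
    · rw [hFx, hF0 v hv, hin]
      exact ((hflip E).ok_x v (hv E).2).1 huv
    · have := hxy' E' E (Or.inr hG'.symm)
      subst this
      exact absurd huv (hasymm _ _ (hxy _))
    · have := hyy E E' (Or.inr hG')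
      subst this
      exact absurd rfl hG'.ne
    · rw [hFy, hF0 v hv, hin]
      exact ((hflip E).ok_y v (hv E).1).1 huv
    · rw [hFx, hF0 u hu, hout]
      exact ((hflip E').ok_x u (hu E').2).2 huv
    · rw [hFy, hF0 u hu, hout]
      exact ((hflip E').ok_y u (hu E').1).2 huv
    · rw [hF0 u hu, hF0 v hv, hin, hout]
      have h1 := Digraph.one_le_outDeg huv
      have h2 := Digraph.one_le_inDeg huv
      omega
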